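/- Let $k$ be a field of characteristic zero and let $V=\bigoplus_{q\ge 1,\ \epsilon\in\mathbb Z_2}V_{q,\epsilon}$ be a $\mathbb Z^{+}\times\mathbb Z_2$-graded $k$-vector space with every $V_{q,\epsilon}$ finite-dimensional; $q$ is called the weight and $\epsilon$ the sign degree. The series of a locally finite-dimensional graded space $W=\bigoplus_{q\ge 0,\,\epsilon} W_{q,\epsilon}$ is $$W(z,y)=\sum_{q\ge 0,\ \epsilon\in\{0,1\}}\dim_k(W_{q,\epsilon})\,z^q y^{\epsilon}\in\mathbb Q[[z]][y]/(y^2-1).$$ Give the tensor algebra $T(V)$ the induced grading, let $T(V)^+$ be its augmentation ideal, and let $[T(V),T(V)]$ be the subspace spanned by the graded commutators $ab-(-1)^{|a||b|}ba$ of homogeneous elements $a,b\in T(V)$, where $|\cdot|$ denotes the sign degree. Then the quotient $$\overline{HC}_0(T(V))=T(V)^+/[T(V),T(V)]$$ is graded by the images of the homogeneous components of $T(V)^+$, these are finite-dimensional, and its series equals $$\mathrm{hcfree}(V)(z,y)=-\sum_{k=1}^{\infty}\frac{\varphi(k)}{k}\,\log\bigl(1-V(z^k,(-1)^{k+1}y^k)\bigr),$$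 where $\varphi$ is Euler's totient function, $\log(1-X)=-\sum_{n\ge1}X^n/n$ for a series $X$ without terms of weight $0$, and the sum over $k$ converges in the sense that each coefficient becomes constant after finitely many terms. -/

import Mathlib

open scoped PowerSeries PowerSeries.WithPiTopology

noncomputable section

namespace CyclicHomology

/-! ### The ring of series in a weight variable `z` and a sign variable `y` with `y ^ 2 = 1` -/

/-- The ring `ℚ[y] / (y ^ 2 - 1)`. -/
abbrev SignRing : Type := AdjoinRoot ((Polynomial.X : Polynomial ℚ) ^ 2 - 1)

namespace SignRing

/-- The class of `y`. -/
def y : SignRing := AdjoinRoot.root ((Polynomial.X : Polynomial ℚ) ^ 2 - 1)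

theorem y_sq : y ^ 2 = 1 := by
  have h := AdjoinRoot.eval₂_root ((Polynomial.X : Polynomial ℚ) ^ 2 - 1)
  simp only [Polynomial.eval₂_sub, Polynomial.eval₂_pow, Polynomial.eval₂_X,
    Polynomial.eval₂_one] at h
  exact sub_eq_zero.mp h

theorem subst_aux (k : ℕ) :
    Polynomial.eval₂ (algebraMap ℚ SignRing) ((-1) ^ (k + 1) * y ^ k)
      ((Polynomial.X : Polynomial ℚ) ^ 2 - 1) = 0 := by
  simp only [Polynomial.eval₂_sub, Polynomial.eval₂_pow, Polynomial.eval₂_X,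
    Polynomial.eval₂_one]
  rw [mul_pow, ← pow_mul, ← pow_mul, mul_comm k 2, pow_mul y, y_sq, mul_comm (k + 1) 2,
    pow_mul, neg_one_sq, one_pow, one_pow, one_mul, sub_self]

/-- The ring endomorphism of `ℚ[y] / (y ^ 2 - 1)` given by the substitution
`y ↦ (-1) ^ (k + 1) * y ^ k`. -/
def subst (k : ℕ) : SignRing →+* SignRing :=
  AdjoinRoot.lift (algebraMap ℚ SignRing) ((-1) ^ (k + 1) * y ^ k) (subst_aux k)

/-- The coefficient ring is discrete, so that two power series in `z` are close in the product
topology exactly when they agree up to a large power of `z`. -/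
instance : TopologicalSpace SignRing := ⊥

instance : DiscreteTopology SignRing := ⟨rfl⟩

end SignRing

/-- The ring `ℚ⟦z⟧[y] / (y ^ 2 - 1)`, written as power series in `z` over `ℚ[y] / (y ^ 2 - 1)`. -/
abbrev SignSeries : Type := PowerSeries SignRing

/-- The substitution `F(z, y) ↦ F(z ^ k, (-1) ^ (k + 1) * y ^ k)` for `k ≥ 1`. -/
def powerSubst (k : ℕ+) (F : SignSeries) : SignSeries :=
  PowerSeries.expand (k : ℕ) k.ne_zero (PowerSeries.map (SignRing.subst k) F)

/-- The `k`-th term `(φ(k) / k) * log (1 - F(z ^ k, (-1) ^ (k + 1) * y ^ k))`. -/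
def hcfreeTerm (F : SignSeries) (k : ℕ+) : SignSeries :=
  ((Nat.totient k : ℚ) / (k : ℚ)) • PowerSeries.logOf (1 - powerSubst k F)

/-- `hcfree(F) = - ∑_{k ≥ 1} (φ(k) / k) * log (1 - F(z ^ k, (-1) ^ (k + 1) * y ^ k))`. -/
def hcfree (F : SignSeries) : SignSeries := -∑' k : ℕ+, hcfreeTerm F k

/-! ### Spaces graded by weight and sign degree -/

section Spaces

variable {K : Type*} [Field K] {V : Type*} [AddCommGroup V] [Module K V]

/-- The series `∑ dim W_{q, ε} z ^ q y ^ ε` of a family of subspaces indexed by the weight `q` and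
the sign degree `ε`. -/
def hilbertSeries (W : ℕ × ZMod 2 → Submodule K V) : SignSeries :=
  PowerSeries.mk fun q =>
    ∑ ε : ZMod 2, (Module.finrank K (W (q, ε)) : SignRing) * SignRing.y ^ ε.val

/-- The component of degree `d` of the tensor algebra of a graded space: the span of all products
`v₁ ⋯ vₙ` (`n ≥ 0`) of homogeneous elements of `V` whose degrees add up to `d`. -/
def tensorPiece (𝒱 : ℕ × ZMod 2 → Submodule K V) (d : ℕ × ZMod 2) :
    Submodule K (TensorAlgebra K V) :=
  Submodule.span K {x | ∃ l : List ((ℕ × ZMod 2) × V),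
    (∀ p ∈ l, p.2 ∈ 𝒱 p.1) ∧ (l.map Prod.fst).sum = d ∧
      x = (l.map fun p => TensorAlgebra.ι K p.2).prod}

/-- The subspace `[T(V), T(V)]` spanned by the graded commutators `a b - (-1) ^ (|a| |b|) b a`
of homogeneous elements. -/
def gradedCommutators (𝒱 : ℕ × ZMod 2 → Submodule K V) : Submodule K (TensorAlgebra K V) :=
  Submodule.span K {x | ∃ (q r : ℕ) (ε δ : ZMod 2) (a b : TensorAlgebra K V),
    a ∈ tensorPiece 𝒱 (q, ε) ∧ b ∈ tensorPiece 𝒱 (r, δ) ∧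
      x = a * b - (-1 : K) ^ (ε.val * δ.val) • (b * a)}

variable (K V) in
/-- The augmentation ideal `T(V)⁺`, the kernel of the projection `T(V) → K` that kills `V`. -/
def augmentationIdeal : Submodule K (TensorAlgebra K V) :=
  LinearMap.ker (TensorAlgebra.algebraMapInv : TensorAlgebra K V →ₐ[K] K).toLinearMap

/-- `HC₀(T(V)) = T(V)⁺ / [T(V), T(V)]`. -/
abbrev HCZero (𝒱 : ℕ × ZMod 2 → Submodule K V) : Type _ :=
  augmentationIdeal K V ⧸ (gradedCommutators 𝒱).submoduleOf (augmentationIdeal K V)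

/-- The component of degree `d` of `HC₀(T(V))`: the image of the component of `T(V)⁺`. -/
def hcPiece (𝒱 : ℕ × ZMod 2 → Submodule K V) (d : ℕ × ZMod 2) : Submodule K (HCZero 𝒱) :=
  ((tensorPiece 𝒱 d).submoduleOf (augmentationIdeal K V)).map
    ((gradedCommutators 𝒱).submoduleOf (augmentationIdeal K V)).mkQ

end Spaces

end CyclicHomology

end

noncomputable section

namespace CyclicHomology

open Module

/-! ### Signs -/

/-- The Koszul sign `(-1) ^ (ε * δ)` in a ring. -/
def koszulSign (R : Type*) [CommRing R] (ε δ : ZMod 2) : R := (-1) ^ (ε.val * δ.val)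

section Sign

variable (R : Type*) [CommRing R]

theorem koszulSign_comm (ε δ : ZMod 2) : koszulSign R ε δ = koszulSign R δ ε := by
  simp [koszulSign, mul_comm]

theorem koszulSign_add_left (ε ε' δ : ZMod 2) :
    koszulSign R (ε + ε') δ = koszulSign R ε δ * koszulSign R ε' δ := by
  simp only [koszulSign, ← pow_add, ← add_mul, ZMod.val_add]
  rw [neg_one_pow_eq_pow_mod_two, neg_one_pow_eq_pow_mod_two (_ * _)]
  simp [Nat.mul_mod]

theorem koszulSign_add_right (ε δ δ' : ZMod 2) :
    koszulSign R ε (δ + δ') = koszulSign R ε δ * koszulSign R ε δ' := by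
  simp only [koszulSign_comm R ε, koszulSign_add_left]

@[simp] theorem koszulSign_zero_left (δ : ZMod 2) : koszulSign R 0 δ = 1 := by simp [koszulSign]

@[simp] theorem koszulSign_zero_right (δ : ZMod 2) : koszulSign R δ 0 = 1 := by simp [koszulSign]

theorem koszulSign_mul_self (ε δ : ZMod 2) : koszulSign R ε δ * koszulSign R ε δ = 1 := by
  rw [koszulSign, ← mul_pow]; simp

end Sign

/-! ### Words -/

section Words

variable {I : Type*} (deg : I → ℕ × ZMod 2)

/-- The total degree of a word. -/
def wordDeg (l : List I) : ℕ × ZMod 2 := (l.map deg).sum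

@[simp] theorem wordDeg_nil : wordDeg deg [] = 0 := rfl

@[simp] theorem wordDeg_cons (a : I) (l : List I) :
    wordDeg deg (a :: l) = deg a + wordDeg deg l := by simp [wordDeg]

@[simp] theorem wordDeg_append (l m : List I) :
    wordDeg deg (l ++ m) = wordDeg deg l + wordDeg deg m := by simp [wordDeg]

variable {K : Type*} [Field K] {V : Type*} [AddCommGroup V] [Module K V] (b : Basis I K V)

/-- The product in the tensor algebra of the basis vectors indexed by a word. -/
def wordProd (l : List I) : TensorAlgebra K V := (l.map fun i => TensorAlgebra.ι K (b i)).prod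

@[simp] theorem wordProd_nil : wordProd b [] = 1 := rfl

theorem wordProd_append (l m : List I) : wordProd b (l ++ m) = wordProd b l * wordProd b m := by
  simp [wordProd]

/-- The basis of the tensor algebra given by the words in a basis. -/
def wordBasis : Basis (List I) K (TensorAlgebra K V) := b.tensorAlgebra.reindex FreeMonoid.toList

@[simp] theorem wordBasis_apply (l : List I) : wordBasis b l = wordProd b l := by
  have h : FreeAlgebra.basisFreeMonoid K I (FreeMonoid.ofList l) =
      (l.map (FreeAlgebra.ι K)).prod := by
    simp only [FreeAlgebra.basisFreeMonoid, Basis.map_apply, Finsupp.coe_basisSingleOne]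
    change FreeAlgebra.equivMonoidAlgebraFreeMonoid.symm
      (MonoidAlgebra.single (FreeMonoid.ofList l) 1) = _
    change (MonoidAlgebra.lift K (FreeAlgebra K I) (FreeMonoid I)
      (FreeMonoid.lift (FreeAlgebra.ι K))) _ = _
    simp [FreeMonoid.lift_apply]
  simp only [wordBasis, Basis.reindex_apply, Basis.tensorAlgebra, Basis.map_apply]
  change (TensorAlgebra.equivFreeAlgebra b).symm
    (FreeAlgebra.basisFreeMonoid K I (FreeMonoid.ofList l)) = _
  rw [h, map_list_prod, List.map_map]
  simp only [wordProd]
  congr 2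
  ext i
  simp

/-- The signed rotation of a word: `v₁ v₂ ⋯ vₙ ↦ ± v₂ ⋯ vₙ v₁`. -/
def rotateWord : List I → TensorAlgebra K V
  | [] => 1
  | a :: l => koszulSign K (deg a).2 (wordDeg deg l).2 • wordProd b (l ++ [a])

/-- The signed rotation of the tensor algebra: `v₁ v₂ ⋯ vₙ ↦ ± v₂ ⋯ vₙ v₁`. -/
def rotation : TensorAlgebra K V →ₗ[K] TensorAlgebra K V :=
  (wordBasis b).constr K (rotateWord deg b)

theorem rotation_wordProd (l : List I) : rotation deg b (wordProd b l) = rotateWord deg b l := by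
  rw [← wordBasis_apply, rotation, Basis.constr_basis]

theorem rotation_one : rotation deg b 1 = 1 := rotation_wordProd deg b []

theorem rotation_cons (a : I) (l : List I) : rotation deg b (wordProd b (a :: l)) =
    koszulSign K (deg a).2 (wordDeg deg l).2 • wordProd b (l ++ [a]) :=
  rotation_wordProd deg b (a :: l)

theorem rotation_pow_append (l m : List I) :
    (rotation deg b ^ l.length) (wordProd b (l ++ m)) =
      koszulSign K (wordDeg deg l).2 (wordDeg deg m).2 • wordProd b (m ++ l) := by
  induction l generalizing m with
  | nil => simp
  | cons a l ih =>
    rw [List.length_cons, pow_succ, Module.End.mul_apply, List.cons_append, rotation_cons,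
      map_smul, List.append_assoc, ih, smul_smul]
    simp only [wordDeg_append, wordDeg_cons, wordDeg_nil, Prod.snd_add, koszulSign_add_left,
      koszulSign_add_right, List.append_assoc, add_zero, List.singleton_append]
    congr 1
    rw [koszulSign_comm K (wordDeg deg l).2 (deg a).2]
    linear_combination (koszulSign K (deg a).2 (wordDeg deg m).2 *
      koszulSign K (wordDeg deg l).2 (wordDeg deg m).2) *
      koszulSign_mul_self K (deg a).2 (wordDeg deg l).2

theorem rotation_pow_length (l : List I) :
    (rotation deg b ^ l.length) (wordProd b l) = wordProd b l := by
  simpa using rotation_pow_append deg b l []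

theorem rotation_pow_wordProd (l : List I) {i : ℕ} (hi : i ≤ l.length) :
    (rotation deg b ^ i) (wordProd b l) =
      koszulSign K (wordDeg deg (l.take i)).2 (wordDeg deg (l.drop i)).2 •
        wordProd b (l.rotate i) := by
  have := rotation_pow_append deg b (l.take i) (l.drop i)
  rwa [List.take_append_drop, List.length_take_of_le hi, ← List.rotate_eq_drop_append_take hi]
    at this

/-- The average of the signed rotations of a word; the empty word goes to zero. -/
def cyclicAverage : TensorAlgebra K V →ₗ[K] TensorAlgebra K V :=
  (wordBasis b).constr K fun l =>
    (l.length : K)⁻¹ • ∑ i ∈ Finset.range l.length, (rotation deg b ^ i) (wordProd b l)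

theorem cyclicAverage_wordProd (l : List I) : cyclicAverage deg b (wordProd b l) =
    (l.length : K)⁻¹ • ∑ i ∈ Finset.range l.length, (rotation deg b ^ i) (wordProd b l) := by
  rw [← wordBasis_apply b l, cyclicAverage, Basis.constr_basis, wordBasis_apply]

theorem cyclicAverage_one : cyclicAverage deg b 1 = 0 := by
  simpa using cyclicAverage_wordProd deg b []

theorem cyclicAverage_comp_rotation :
    cyclicAverage deg b ∘ₗ rotation deg b = cyclicAverage deg b := by
  refine (wordBasis b).ext fun l => ?_
  rw [LinearMap.comp_apply, wordBasis_apply]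
  match l with
  | [] => simp [rotation_one]
  | a :: l =>
    rw [rotation_cons, map_smul, cyclicAverage_wordProd, cyclicAverage_wordProd, smul_comm,
      Finset.smul_sum]
    simp only [← map_smul, ← rotation_cons, List.length_append,
      List.length_cons, List.length_nil, zero_add]
    congr 1
    rw [Finset.sum_range_succ, Finset.sum_range_succ']
    simp only [← Module.End.mul_apply, ← pow_succ]
    rw [show (rotation deg b ^ (l.length + 1)) (wordProd b (a :: l)) = wordProd b (a :: l) from
      rotation_pow_length deg b (a :: l)]
    simp

theorem cyclicAverage_rotation_pow (i : ℕ) (x : TensorAlgebra K V) :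
    cyclicAverage deg b ((rotation deg b ^ i) x) = cyclicAverage deg b x := by
  induction i with
  | zero => simp
  | succ i ih =>
    rw [pow_succ', Module.End.mul_apply, ← LinearMap.comp_apply, cyclicAverage_comp_rotation, ih]

theorem cyclicAverage_mul_comm (l m : List I) :
    cyclicAverage deg b (wordProd b l * wordProd b m) =
      koszulSign K (wordDeg deg l).2 (wordDeg deg m).2 •
        cyclicAverage deg b (wordProd b m * wordProd b l) := by
  rw [← wordProd_append, ← cyclicAverage_rotation_pow deg b l.length, rotation_pow_append,
    map_smul, wordProd_append]

theorem wordBasis_repr_cyclicAverage [DecidableEq I] (l : List I) :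
    (wordBasis b).repr (cyclicAverage deg b (wordProd b l)) l =
      (l.length : K)⁻¹ * ∑ i ∈ Finset.range l.length, if l.rotate i = l then
        koszulSign K (wordDeg deg (l.take i)).2 (wordDeg deg (l.drop i)).2 else 0 := by
  rw [cyclicAverage_wordProd, map_smul, map_sum, Finsupp.smul_apply, Finsupp.finsetSum_apply,
    smul_eq_mul]
  congr 1
  refine Finset.sum_congr rfl fun i hi => ?_
  rw [rotation_pow_wordProd deg b l (Finset.mem_range.1 hi).le, map_smul, ← wordBasis_apply,
    Basis.repr_self, Finsupp.smul_apply, Finsupp.single_apply, smul_eq_mul, mul_ite, mul_one,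
    mul_zero]

end Words

/-- The dimension of the image of a coordinate subspace under a linear map that restricts to a
projection of that subspace is the trace of the map. -/
theorem finrank_map_span_eq_sum {K T ι : Type*} [Field K] [AddCommGroup T] [Module K T]
    (B : Basis ι K T) (P : T →ₗ[K] T) (S : Finset ι)
    (hmem : ∀ x ∈ Submodule.span K (B '' S), P x ∈ Submodule.span K (B '' S))
    (hidem : ∀ x ∈ Submodule.span K (B '' S), P (P x) = P x) :
    (finrank K ((Submodule.span K (B '' S)).map P) : K) = ∑ i ∈ S, B.repr (P (B i)) i := by
  classical
  set W := Submodule.span K (B '' S) with hW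
  have hli : LinearIndependent K (fun i : S => B i) :=
    B.linearIndependent.comp _ Subtype.val_injective
  have hr : Submodule.span K (Set.range fun i : S => B i) = W := by
    rw [hW]; congr 1; ext x; simp
  let b : Basis S K W := (Basis.span hli).map (LinearEquiv.ofEq _ _ hr)
  have hb : ∀ i, (b i : T) = B i := fun i => by simp [b, Basis.span_apply]
  have hrepr : ∀ (x : W) (i : S), b.repr x i = B.repr (x : T) i := fun x i => by
    have : (Finsupp.lapply i) ∘ₗ b.repr.toLinearMap =
        (Finsupp.lapply (i : ι)) ∘ₗ B.repr.toLinearMap ∘ₗ W.subtype := by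
      refine b.ext fun j => ?_
      simp [hb, Finsupp.single_apply]
    exact LinearMap.congr_fun this x
  have : FiniteDimensional K W := b.finiteDimensional_of_finite
  let p : W →ₗ[K] W := P.restrict hmem
  have hp : LinearMap.IsProj (LinearMap.range p) p :=
    ⟨fun x => LinearMap.mem_range_self _ _, by
      rintro _ ⟨x, rfl⟩
      exact Subtype.ext (hidem _ x.2)⟩
  have hmap : W.map P = (LinearMap.range p).map W.subtype := by
    rw [← LinearMap.range_comp]
    ext x
    simp [p, LinearMap.mem_range, Submodule.mem_map]
  rw [hmap, LinearEquiv.finrank_eq (Submodule.equivMapOfInjective _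
    W.subtype_injective (LinearMap.range p)).symm, ← hp.trace, LinearMap.trace_eq_matrix_trace K b,
    Matrix.trace, ← Finset.sum_coe_sort S]
  refine Finset.sum_congr rfl fun i _ => ?_
  rw [Matrix.diag_apply, LinearMap.toMatrix_apply, hrepr, LinearMap.coe_restrict_apply, hb]

section Graded

variable {I K V : Type*} [Field K] [AddCommGroup V] [Module K V] (b : Basis I K V)
  (deg : I → ℕ × ZMod 2) (𝒱 : ℕ × ZMod 2 → Submodule K V)
  (h𝒱 : ∀ d, 𝒱 d = Submodule.span K (b '' {i | deg i = d}))

/-- The span of the words of degree `d`. -/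
def wordSpan (d : ℕ × ZMod 2) : Submodule K (TensorAlgebra K V) :=
  Submodule.span K (wordBasis b '' {l | wordDeg deg l = d})

variable {b deg} in
theorem wordProd_mem_wordSpan {d : ℕ × ZMod 2} {l : List I} (h : wordDeg deg l = d) :
    wordProd b l ∈ wordSpan b deg d :=
  Submodule.subset_span ⟨l, h, wordBasis_apply b l⟩

variable {b deg} in
theorem mul_mem_wordSpan {d e : ℕ × ZMod 2} {x y : TensorAlgebra K V}
    (hx : x ∈ wordSpan b deg d) (hy : y ∈ wordSpan b deg e) :
    x * y ∈ wordSpan b deg (d + e) := by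
  have h : wordSpan b deg d * wordSpan b deg e ≤ wordSpan b deg (d + e) := by
    rw [wordSpan, wordSpan, Submodule.span_mul_span, Submodule.span_le]
    rintro _ ⟨_, ⟨l, hl, rfl⟩, _, ⟨m, hm, rfl⟩, rfl⟩
    simp only [Set.mem_ofPred_eq] at hl hm
    simp only [wordBasis_apply, ← wordProd_append]
    exact wordProd_mem_wordSpan (by simp [hl, hm])
  exact h (Submodule.mul_mem_mul hx hy)

theorem rotation_mem_wordSpan {d : ℕ × ZMod 2} {x : TensorAlgebra K V}
    (hx : x ∈ wordSpan b deg d) : rotation deg b x ∈ wordSpan b deg d := by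
  induction hx using Submodule.span_induction with
  | zero => simp
  | add x y _ _ hx hy => rw [map_add]; exact add_mem hx hy
  | smul c x _ hx => rw [map_smul]; exact Submodule.smul_mem _ _ hx
  | mem x hx =>
    obtain ⟨l, hl, rfl⟩ := hx
    simp only [Set.mem_ofPred_eq] at hl
    rw [wordBasis_apply]
    match l with
    | [] => rw [wordProd_nil, rotation_one]; exact wordProd_mem_wordSpan (b := b) hl
    | a :: l =>
      rw [rotation_cons]
      refine Submodule.smul_mem _ _ (wordProd_mem_wordSpan ?_)
      simp only [← hl, wordDeg_append, wordDeg_cons, wordDeg_nil]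
      abel

theorem cyclicAverage_mem_wordSpan {d : ℕ × ZMod 2} {x : TensorAlgebra K V}
    (hx : x ∈ wordSpan b deg d) : cyclicAverage deg b x ∈ wordSpan b deg d := by
  induction hx using Submodule.span_induction with
  | zero => simp
  | add x y _ _ hx hy => rw [map_add]; exact add_mem hx hy
  | smul c x _ hx => rw [map_smul]; exact Submodule.smul_mem _ _ hx
  | mem x hx =>
    obtain ⟨l, hl, rfl⟩ := hx
    rw [wordBasis_apply, cyclicAverage_wordProd]
    refine Submodule.smul_mem _ _ (sum_mem fun i hi => ?_)
    clear hi
    induction i with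
    | zero => exact wordProd_mem_wordSpan hl
    | succ i ih =>
      rw [pow_succ', Module.End.mul_apply]
      exact rotation_mem_wordSpan b deg ih

theorem iSupIndep_wordSpan : iSupIndep (wordSpan b deg) := by
  refine iSupIndep_def.2 fun d => ?_
  refine ((wordBasis b).linearIndependent.disjoint_span_image
    (s := {l | wordDeg deg l = d}) (t := {l | wordDeg deg l ≠ d}) ?_).mono_right ?_
  · exact Set.disjoint_left.2 fun l h h' => h' h
  · refine iSup₂_le fun e he => Submodule.span_mono (Set.image_mono fun l hl => ?_)
    simp only [Set.mem_ofPred_eq] at hl ⊢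
    rwa [hl]

include h𝒱 in
theorem tensorPiece_eq_wordSpan (d : ℕ × ZMod 2) : tensorPiece 𝒱 d = wordSpan b deg d := by
  refine le_antisymm (Submodule.span_le.2 ?_) (Submodule.span_le.2 ?_)
  · rintro _ ⟨l, hl, rfl, rfl⟩
    induction l with
    | nil => exact wordProd_mem_wordSpan (b := b) (l := []) rfl
    | cons p l ih =>
      simp only [List.map_cons, List.sum_cons, List.prod_cons]
      refine mul_mem_wordSpan ?_ (ih fun q hq => hl q (List.mem_cons_of_mem _ hq))
      have hp := hl p List.mem_cons_self
      rw [h𝒱] at hp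
      have := Submodule.mem_map_of_mem (f := TensorAlgebra.ι K) hp
      rw [Submodule.map_span] at this
      refine Submodule.span_le.2 ?_ this
      rintro _ ⟨_, ⟨i, hi, rfl⟩, rfl⟩
      have := wordProd_mem_wordSpan (b := b) (deg := deg) (d := p.1) (l := [i]) (by simpa using hi)
      simpa [wordProd] using this
  · rintro _ ⟨l, hl, rfl⟩
    refine Submodule.subset_span ⟨l.map fun i => (deg i, b i), ?_, ?_, ?_⟩
    · simp only [List.mem_map]
      rintro _ ⟨i, _, rfl⟩
      rw [h𝒱]
      exact Submodule.subset_span ⟨i, rfl, rfl⟩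
    · simpa [wordDeg, Function.comp_def] using hl
    · simp [wordProd, Function.comp_def]

theorem algebraMapInv_wordProd (l : List I) :
    TensorAlgebra.algebraMapInv (wordProd b l) = if l = [] then (1 : K) else 0 := by
  cases l with
  | nil => simp
  | cons a l => simp [wordProd, TensorAlgebra.algebraMapInv]

theorem wordProd_mem_augmentationIdeal {l : List I} (hl : l ≠ []) :
    wordProd b l ∈ augmentationIdeal K V := by
  rw [augmentationIdeal, LinearMap.mem_ker]
  simp [algebraMapInv_wordProd, hl]

include h𝒱 in
theorem commutator_mem_gradedCommutators (l m : List I) :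
    wordProd b (l ++ m) - koszulSign K (wordDeg deg l).2 (wordDeg deg m).2 • wordProd b (m ++ l) ∈
      gradedCommutators 𝒱 := by
  refine Submodule.subset_span ⟨(wordDeg deg l).1, (wordDeg deg m).1, (wordDeg deg l).2,
    (wordDeg deg m).2, wordProd b l, wordProd b m, ?_, ?_, ?_⟩
  · rw [tensorPiece_eq_wordSpan b deg 𝒱 h𝒱]; exact wordProd_mem_wordSpan rfl
  · rw [tensorPiece_eq_wordSpan b deg 𝒱 h𝒱]; exact wordProd_mem_wordSpan rfl
  · simp only [wordProd_append, koszulSign]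

include h𝒱 in
theorem cyclicAverage_eq_zero {x : TensorAlgebra K V} (hx : x ∈ gradedCommutators 𝒱) :
    cyclicAverage deg b x = 0 := by
  rw [← LinearMap.mem_ker]
  refine Submodule.span_le.2 ?_ hx
  rintro _ ⟨q, r, ε, δ, x, y, hx, hy, rfl⟩
  rw [tensorPiece_eq_wordSpan b deg 𝒱 h𝒱] at hx hy
  rw [SetLike.mem_coe, LinearMap.mem_ker]
  induction hx using Submodule.span_induction with
  | zero => simp
  | add x x' _ _ hx hx' =>
    simp only [add_mul, mul_add, smul_add, add_sub_add_comm, map_add, hx, hx', add_zero]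
  | smul c x _ hx =>
    simp only [smul_mul_assoc, mul_smul_comm, smul_comm _ c, ← smul_sub, map_smul, hx, smul_zero]
  | mem x hx =>
    obtain ⟨l, hl, rfl⟩ := hx
    induction hy using Submodule.span_induction with
    | zero => simp
    | add x x' _ _ hx hx' =>
      simp only [add_mul, mul_add, smul_add, add_sub_add_comm, map_add, hx, hx', add_zero]
    | smul c x _ hx =>
      simp only [smul_mul_assoc, mul_smul_comm, smul_comm _ c, ← smul_sub, map_smul, hx, smul_zero]
    | mem y hy =>
      obtain ⟨m, hm, rfl⟩ := hy
      simp only [Set.mem_ofPred_eq] at hl hm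
      rw [wordBasis_apply, wordBasis_apply, map_sub, cyclicAverage_mul_comm, map_smul, hl, hm,
        koszulSign, sub_self]

include h𝒱 in
theorem sub_cyclicAverage_mem [CharZero K] {x : TensorAlgebra K V}
    (hx : x ∈ augmentationIdeal K V) : x - cyclicAverage deg b x ∈ gradedCommutators 𝒱 := by
  have key : (gradedCommutators 𝒱).mkQ ∘ₗ (LinearMap.id - cyclicAverage deg b -
      (Algebra.linearMap K _) ∘ₗ
        (TensorAlgebra.algebraMapInv : TensorAlgebra K V →ₐ[K] K).toLinearMap) = 0 := by
    refine (wordBasis b).ext fun l => ?_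
    simp only [wordBasis_apply, LinearMap.comp_apply, LinearMap.zero_apply, Submodule.mkQ_apply,
      Submodule.Quotient.mk_eq_zero, LinearMap.sub_apply, LinearMap.id_apply,
      AlgHom.toLinearMap_apply, algebraMapInv_wordProd, Algebra.linearMap_apply]
    rcases eq_or_ne l [] with rfl | hl
    · simp [cyclicAverage_one]
    · have hn : (l.length : K) ≠ 0 := by simpa using hl
      have : wordProd b l - cyclicAverage deg b (wordProd b l) = (l.length : K)⁻¹ •
          ∑ i ∈ Finset.range l.length, (wordProd b l - (rotation deg b ^ i) (wordProd b l)) := by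
        rw [cyclicAverage_wordProd, Finset.sum_sub_distrib, smul_sub, Finset.sum_const,
          Finset.card_range, ← Nat.cast_smul_eq_nsmul K, smul_smul, inv_mul_cancel₀ hn, one_smul]
      rw [if_neg hl, map_zero, sub_zero, this]
      refine Submodule.smul_mem _ _ (sum_mem fun i hi => ?_)
      rw [rotation_pow_wordProd deg b l (Finset.mem_range.1 hi).le,
        List.rotate_eq_drop_append_take (Finset.mem_range.1 hi).le]
      simpa only [List.take_append_drop] using
        commutator_mem_gradedCommutators b deg 𝒱 h𝒱 (l.take i) (l.drop i)
  have := LinearMap.congr_fun key x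
  have hx' : TensorAlgebra.algebraMapInv x = 0 := hx
  rw [← Submodule.Quotient.mk_eq_zero]
  simpa [hx'] using this

/-- The embedding of `HC₀(T(V))` in `T(V)` induced by the average over signed rotations. -/
def hcEmbedding : HCZero 𝒱 →ₗ[K] TensorAlgebra K V :=
  Submodule.liftQ _ (cyclicAverage deg b ∘ₗ (augmentationIdeal K V).subtype) fun x hx => by
    exact cyclicAverage_eq_zero b deg 𝒱 h𝒱 hx

theorem hcEmbedding_mk (x : augmentationIdeal K V) :
    hcEmbedding b deg 𝒱 h𝒱 (Submodule.mkQ _ x) = cyclicAverage deg b x := rfl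

theorem hcEmbedding_injective [CharZero K] :
    Function.Injective (hcEmbedding b deg 𝒱 h𝒱) := by
  rw [← LinearMap.ker_eq_bot, LinearMap.ker_eq_bot']
  intro x hx
  obtain ⟨x, rfl⟩ := Submodule.mkQ_surjective _ x
  rw [hcEmbedding_mk] at hx
  have := sub_cyclicAverage_mem b deg 𝒱 h𝒱 x.2
  rw [hx, sub_zero] at this
  exact (Submodule.Quotient.mk_eq_zero _).2 this

theorem map_hcEmbedding_hcPiece (d : ℕ × ZMod 2) :
    (hcPiece 𝒱 d).map (hcEmbedding b deg 𝒱 h𝒱) =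
      (wordSpan b deg d).map (cyclicAverage deg b) := by
  rw [hcPiece, tensorPiece_eq_wordSpan b deg 𝒱 h𝒱]
  refine le_antisymm ?_ ?_
  · rintro _ ⟨_, ⟨x, hx, rfl⟩, rfl⟩
    exact ⟨x, hx, rfl⟩
  · rw [Submodule.map_le_iff_le_comap]
    refine Submodule.span_le.2 ?_
    rintro _ ⟨l, hl, rfl⟩
    rw [wordBasis_apply, SetLike.mem_coe, Submodule.mem_comap]
    rcases eq_or_ne l [] with rfl | hn
    · rw [wordProd_nil, cyclicAverage_one]; exact zero_mem _
    · exact ⟨_, ⟨⟨_, wordProd_mem_augmentationIdeal b hn⟩, wordProd_mem_wordSpan hl, rfl⟩, rfl⟩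

include h𝒱 b in
theorem isInternal_hcPiece [CharZero K] : DirectSum.IsInternal (hcPiece 𝒱) := by
  refine DirectSum.isInternal_submodule_of_iSupIndep_of_iSup_eq_top ?_ ?_
  · refine iSupIndep_def.2 fun d => ?_
    rw [disjoint_iff]
    refine Submodule.map_injective_of_injective (hcEmbedding_injective b deg 𝒱 h𝒱) ?_
    rw [Submodule.map_inf _ (hcEmbedding_injective b deg 𝒱 h𝒱), Submodule.map_bot,
      ← disjoint_iff]
    simp only [Submodule.map_iSup, map_hcEmbedding_hcPiece]
    have hle : ∀ d, (wordSpan b deg d).map (cyclicAverage deg b) ≤ wordSpan b deg d := fun d => by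
      rintro _ ⟨x, hx, rfl⟩
      exact cyclicAverage_mem_wordSpan b deg hx
    exact (iSupIndep_def.1 (iSupIndep_wordSpan b deg) d).mono (hle d)
      (iSup₂_mono fun e _ => hle e)
  · have h : ∀ x : TensorAlgebra K V,
        ∃ y : augmentationIdeal K V, Submodule.mkQ _ y ∈ iSup (hcPiece 𝒱) ∧
          (y : TensorAlgebra K V) = x - algebraMap K _ (TensorAlgebra.algebraMapInv x) := by
      intro x
      induction (wordBasis b).mem_span x using Submodule.span_induction with
      | zero => exact ⟨0, by simp⟩
      | add x x' _ _ hx hx' =>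
        obtain ⟨y, hy, e⟩ := hx
        obtain ⟨y', hy', e'⟩ := hx'
        refine ⟨y + y', by rw [map_add]; exact add_mem hy hy', ?_⟩
        rw [Submodule.coe_add, e, e', map_add, map_add]; abel
      | smul c x _ hx =>
        obtain ⟨y, hy, e⟩ := hx
        refine ⟨c • y, by rw [map_smul]; exact Submodule.smul_mem _ _ hy, ?_⟩
        rw [Submodule.coe_smul, e, map_smul, smul_sub, Algebra.algebraMap_eq_smul_one,
          Algebra.algebraMap_eq_smul_one, smul_assoc]
      | mem x hx =>
        obtain ⟨l, rfl⟩ := hx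
        rw [wordBasis_apply, algebraMapInv_wordProd]
        rcases eq_or_ne l [] with rfl | hn
        · exact ⟨0, by simp⟩
        · refine ⟨⟨_, wordProd_mem_augmentationIdeal b hn⟩, ?_, by simp [hn]⟩
          refine Submodule.mem_iSup_of_mem (wordDeg deg l) ⟨_, ?_, rfl⟩
          rw [tensorPiece_eq_wordSpan b deg 𝒱 h𝒱]
          exact wordProd_mem_wordSpan (b := b) rfl
    refine eq_top_iff.2 fun x _ => ?_
    obtain ⟨x, rfl⟩ := Submodule.mkQ_surjective _ x
    obtain ⟨y, hy, e⟩ := h x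
    have hx' : TensorAlgebra.algebraMapInv (x : TensorAlgebra K V) = 0 := x.2
    rw [hx', map_zero, sub_zero] at e
    rwa [← Subtype.ext e]

include h𝒱 b in
theorem finiteDimensional_hcPiece [CharZero K] {d : ℕ × ZMod 2}
    (hd : {l | wordDeg deg l = d}.Finite) : FiniteDimensional K (hcPiece 𝒱 d) := by
  have h : FiniteDimensional K ((hcPiece 𝒱 d).map (hcEmbedding b deg 𝒱 h𝒱)) := by
    rw [map_hcEmbedding_hcPiece]
    have : FiniteDimensional K (wordSpan b deg d) :=
      FiniteDimensional.span_of_finite K (hd.image _)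
    infer_instance
  exact LinearEquiv.finiteDimensional (Submodule.equivMapOfInjective _
    (hcEmbedding_injective b deg 𝒱 h𝒱) (hcPiece 𝒱 d)).symm

include h𝒱 in
theorem finrank_hcPiece [CharZero K] [DecidableEq I] {d : ℕ × ZMod 2} (S : Finset (List I))
    (hS : ∀ l, l ∈ S ↔ wordDeg deg l = d) :
    (finrank K (hcPiece 𝒱 d) : K) = ∑ l ∈ S, (l.length : K)⁻¹ *
      ∑ i ∈ Finset.range l.length, if l.rotate i = l then
        koszulSign K (wordDeg deg (l.take i)).2 (wordDeg deg (l.drop i)).2 else 0 := by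
  have hspan : wordSpan b deg d = Submodule.span K (wordBasis b '' S) := by
    rw [wordSpan]; congr 2; ext l; simp [hS]
  rw [LinearEquiv.finrank_eq (Submodule.equivMapOfInjective _
    (hcEmbedding_injective b deg 𝒱 h𝒱) (hcPiece 𝒱 d)), map_hcEmbedding_hcPiece, hspan,
    finrank_map_span_eq_sum]
  · exact Finset.sum_congr rfl fun l _ => by
      rw [wordBasis_apply, wordBasis_repr_cyclicAverage]
  · rw [← hspan]
    exact fun x => cyclicAverage_mem_wordSpan b deg
  · intro x _
    have key : cyclicAverage deg b ∘ₗ cyclicAverage deg b = cyclicAverage deg b := by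
      refine (wordBasis b).ext fun l => ?_
      rw [LinearMap.comp_apply, wordBasis_apply]
      rcases eq_or_ne l [] with rfl | hn
      · simp [cyclicAverage_one]
      · have := cyclicAverage_eq_zero b deg 𝒱 h𝒱
          (sub_cyclicAverage_mem b deg 𝒱 h𝒱 (wordProd_mem_augmentationIdeal b hn))
        rwa [map_sub, sub_eq_zero, eq_comm] at this
    exact LinearMap.congr_fun key x

end Graded

/-! ### Words fixed by a rotation -/

section Periodic

variable {I : Type*}

/-- The `k`-fold repetition of a word. -/
def wordPow (u : List I) (k : ℕ) : List I := (List.replicate k u).flatten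

@[simp] theorem wordPow_zero (u : List I) : wordPow u 0 = [] := rfl

theorem wordPow_succ (u : List I) (k : ℕ) : wordPow u (k + 1) = u ++ wordPow u k := by
  simp [wordPow, List.replicate_succ]

theorem wordPow_add (u : List I) (j k : ℕ) : wordPow u (j + k) = wordPow u j ++ wordPow u k := by
  rw [wordPow, List.replicate_add, List.flatten_append, wordPow, wordPow]

theorem length_wordPow (u : List I) (k : ℕ) : (wordPow u k).length = u.length * k := by
  simp [wordPow, mul_comm]

theorem wordDeg_wordPow (deg : I → ℕ × ZMod 2) (u : List I) (k : ℕ) :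
    wordDeg deg (wordPow u k) = k • wordDeg deg u := by
  induction k with
  | zero => simp
  | succ k ih => rw [wordPow_succ, wordDeg_append, ih, succ_nsmul']

theorem take_wordPow (u : List I) (j k : ℕ) :
    (wordPow u (j + k)).take (u.length * j) = wordPow u j := by
  rw [wordPow_add, List.take_left' (length_wordPow u j)]

theorem drop_wordPow (u : List I) (j k : ℕ) :
    (wordPow u (j + k)).drop (u.length * j) = wordPow u k := by
  rw [wordPow_add, List.drop_left' (length_wordPow u j)]

theorem rotate_wordPow (u : List I) (j k : ℕ) :
    (wordPow u (j + k)).rotate (u.length * j) = wordPow u (j + k) := by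
  rw [List.rotate_eq_drop_append_take, take_wordPow, drop_wordPow, ← wordPow_add, add_comm]
  rw [length_wordPow]
  exact Nat.mul_le_mul_left _ (Nat.le_add_right _ _)

theorem eq_wordPow_of_append_comm (u : List I) (k : ℕ) (v : List I)
    (hv : v.length = u.length * k) (h : u ++ v = v ++ u) : v = wordPow u k := by
  induction k generalizing v with
  | zero => simpa using hv
  | succ k ih =>
    have hle : u.length ≤ v.length := by rw [hv]; exact Nat.le_mul_of_pos_right _ k.succ_pos
    have hpre : u <+: v := List.prefix_of_prefix_length_le ⟨v, h⟩ ⟨u, rfl⟩ hle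
    obtain ⟨v', rfl⟩ := hpre
    rw [wordPow_succ, ← ih v']
    · rw [List.length_append, mul_add, mul_one, add_comm] at hv
      exact Nat.add_right_cancel hv
    · rw [List.append_assoc] at h
      exact List.append_cancel_left h

theorem rotate_mul_eq_self {l : List I} {i : ℕ} (h : l.rotate i = l) (m : ℕ) :
    l.rotate (i * m) = l := by
  induction m with
  | zero => simp
  | succ m ih => rw [mul_add, mul_one, ← List.rotate_rotate, ih, h]

theorem rotate_gcd_eq_self {l : List I} {i : ℕ} (h : l.rotate i = l) :
    l.rotate (l.length.gcd i) = l := by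
  rcases eq_or_ne l.length 0 with h0 | h0
  · rw [List.length_eq_zero_iff.1 h0]; simp
  have hb := Nat.gcd_eq_gcd_ab l.length i
  obtain ⟨m, hm⟩ : ∃ m : ℕ, (i * m) % l.length = l.length.gcd i % l.length := by
    refine ⟨((Nat.gcdB l.length i) % l.length).toNat, ?_⟩
    zify
    rw [Int.toNat_of_nonneg (Int.emod_nonneg _ (by exact_mod_cast h0)), hb]
    simp [Int.mul_emod, Int.add_emod]
  rw [← List.rotate_mod, ← hm, List.rotate_mod, rotate_mul_eq_self h]

theorem eq_wordPow_of_rotate_eq {l : List I} {g k : ℕ} (hk : k ≠ 0) (hl : l.length = g * k)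
    (h : l.rotate g = l) : l = wordPow (l.take g) k := by
  obtain ⟨k, rfl⟩ := Nat.exists_eq_succ_of_ne_zero hk
  have hg : g ≤ l.length := by rw [hl]; exact Nat.le_mul_of_pos_right _ k.succ_pos
  have hd : l.drop g = wordPow (l.take g) k := by
    refine eq_wordPow_of_append_comm _ _ _ ?_ ?_
    · rw [List.length_drop, List.length_take_of_le hg, hl, Nat.succ_eq_add_one, mul_add, mul_one,
        Nat.add_sub_cancel]
    · rw [← List.rotate_eq_drop_append_take hg, h, List.take_append_drop]
  rw [Nat.succ_eq_add_one, wordPow_succ, ← hd, List.take_append_drop]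

/-- The embedding that prepends a letter to a word. -/
def consEmbedding (I : Type*) : I × List I ↪ List I where
  toFun p := p.1 :: p.2
  inj' p q h := by
    obtain ⟨h₁, h₂⟩ := List.cons.inj h
    exact Prod.ext h₁ h₂

@[simp] theorem consEmbedding_apply (p : I × List I) : consEmbedding I p = p.1 :: p.2 := rfl

/-- The words of length `n` with letters in `J`. -/
def words (J : Finset I) : ℕ → Finset (List I)
  | 0 => {[]}
  | n + 1 => (J ×ˢ words J n).map (consEmbedding I)

theorem mem_words {J : Finset I} {n : ℕ} {l : List I} :
    l ∈ words J n ↔ l.length = n ∧ ∀ i ∈ l, i ∈ J := by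
  induction n generalizing l with
  | zero => simp +contextual [words, List.length_eq_zero_iff]
  | succ n ih =>
    cases l with
    | nil => simp [words]
    | cons a l => simp [words, ih, and_left_comm]

theorem sum_words {R : Type*} [CommSemiring R] (J : Finset I) (f : I → R) (n : ℕ) :
    ∑ l ∈ words J n, (l.map f).prod = (∑ i ∈ J, f i) ^ n := by
  induction n with
  | zero => simp [words]
  | succ n ih =>
    rw [words, Finset.sum_map, Finset.sum_product, pow_succ', ← ih, Finset.sum_mul_sum]
    simp

end Periodic

/-! ### Counting fixed words -/

namespace SignRing

/-- The value `(-1) ^ (k + 1) * y ^ k` substituted for `y`. -/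
def signY (k : ℕ) : SignRing := (-1) ^ (k + 1) * y ^ k

theorem signY_sq (k : ℕ) : signY k ^ 2 = 1 := by
  rw [signY, mul_pow, ← pow_mul, ← pow_mul, mul_comm k 2, pow_mul y, y_sq]; simp

theorem subst_y (k : ℕ) : subst k y = signY k := AdjoinRoot.lift_root _

end SignRing

open SignRing

theorem pow_val_add {R : Type*} [CommRing R] {t : R} (ht : t ^ 2 = 1) (ε δ : ZMod 2) :
    t ^ (ε + δ).val = t ^ ε.val * t ^ δ.val := by
  rw [← pow_add, ZMod.val_add, ← Nat.mod_add_div (ε.val + δ.val) 2, pow_add, pow_mul, ht]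
  simp

theorem koszulSign_nsmul_mul_pow {j k : ℕ} (h : (j + k).gcd j = 1) (ε : ZMod 2) :
    koszulSign SignRing (j • ε) (k • ε) * y ^ ((j + k) • ε).val = signY (j + k) ^ ε.val := by
  have hε : ε = 0 ∨ ε = 1 := by
    revert ε; decide
  rcases hε with rfl | rfl
  · simp
  have hy : ∀ m : ℕ, y ^ (m % 2) = y ^ m := fun m => by
    conv_rhs => rw [← Nat.mod_add_div m 2, pow_add, pow_mul, y_sq, one_pow, mul_one]
  have hs : ((-1 : SignRing)) ^ (j % 2 * (k % 2)) = (-1) ^ (j + k + 1) := by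
    rw [neg_one_pow_congr]
    have h2 : ¬(j % 2 = 0 ∧ k % 2 = 0) := fun ⟨hj, hk⟩ => by
      have := Nat.dvd_gcd (k := 2) (m := j + k) (n := j) (by omega) (by omega)
      rw [h] at this; omega
    rcases Nat.mod_two_eq_zero_or_one j with hj | hj <;>
    rcases Nat.mod_two_eq_zero_or_one k with hk | hk <;>
    rw [hj, hk, Nat.even_iff, Nat.even_iff] <;> omega
  simp only [koszulSign, nsmul_eq_mul, mul_one, ZMod.val_natCast, hy, ZMod.val_one, pow_one, hs,
    signY]

section Count

variable {I : Type*} [DecidableEq I] (deg : I → ℕ × ZMod 2) (J : Finset I)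

/-- The signed count of words `u` of length `g` whose `k`-fold repetition has weight `q`. -/
def signedCount (q g k : ℕ) : SignRing :=
  ∑ u ∈ words J g with k * (wordDeg deg u).1 = q, signY k ^ (wordDeg deg u).2.val

theorem sum_fixed_eq_signedCount {n i : ℕ} (hi : i < n) (q : ℕ) :
    ∑ l ∈ words J n with (wordDeg deg l).1 = q ∧ l.rotate i = l,
      koszulSign SignRing (wordDeg deg (l.take i)).2 (wordDeg deg (l.drop i)).2 *
        y ^ (wordDeg deg l).2.val = signedCount deg J q (n.gcd i) (n / n.gcd i) := by
  have hn : 0 < n := by omega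
  set g := n.gcd i with hg
  have hg0 : 0 < g := Nat.gcd_pos_of_pos_left _ hn
  obtain ⟨j, hj⟩ : g ∣ i := Nat.gcd_dvd_right _ _
  obtain ⟨k, hk⟩ : g ∣ n := Nat.gcd_dvd_left _ _
  have hjk : j < k := by
    rw [hj, hk] at hi; exact Nat.lt_of_mul_lt_mul_left hi
  obtain ⟨r, rfl⟩ := Nat.exists_eq_add_of_le hjk.le
  have hco : (j + r).gcd j = 1 := by
    have : g * (j + r).gcd j = g * 1 := by rw [← Nat.gcd_mul_left, ← hk, ← hj, mul_one]
    exact Nat.eq_of_mul_eq_mul_left hg0 this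
  have hdiv : n / g = j + r := by rw [hk, Nat.mul_div_cancel_left _ hg0]
  rw [signedCount, hdiv]
  symm
  refine Finset.sum_nbij' (fun u => wordPow u (j + r)) (fun l => l.take g) ?_ ?_ ?_ ?_ ?_
  · intro u hu
    simp only [Finset.mem_filter, mem_words] at hu ⊢
    obtain ⟨⟨hu, hJ⟩, hq⟩ := hu
    refine ⟨⟨by rw [length_wordPow, hu, ← hk], ?_⟩, ?_, ?_⟩
    · intro a ha
      simp only [wordPow, List.mem_flatten, List.mem_replicate] at ha
      obtain ⟨_, ⟨_, rfl⟩, ha⟩ := ha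
      exact hJ a ha
    · rw [wordDeg_wordPow, Prod.smul_fst, smul_eq_mul, hq]
    · rw [hj, ← hu, rotate_wordPow]
  · intro l hl
    simp only [Finset.mem_filter, mem_words] at hl ⊢
    obtain ⟨⟨hl, hJ⟩, hq, hrot⟩ := hl
    have hrg : l.rotate g = l := by rw [hg, ← hl]; exact rotate_gcd_eq_self hrot
    have hle : g ≤ l.length := by rw [hl]; exact Nat.gcd_le_left _ hn
    refine ⟨⟨List.length_take_of_le hle, fun a ha => hJ a (List.mem_of_mem_take ha)⟩, ?_⟩
    rw [← hq]
    conv_rhs => rw [eq_wordPow_of_rotate_eq (by omega) (hl.trans hk) hrg]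
    rw [wordDeg_wordPow, Prod.smul_fst, smul_eq_mul]
  · intro u hu
    simp only [Finset.mem_filter, mem_words] at hu
    obtain ⟨s, hs⟩ := Nat.exists_eq_add_of_lt (Nat.zero_lt_of_lt hjk)
    rw [hs, zero_add, wordPow_succ, List.take_left' hu.1.1]
  · intro l hl
    simp only [Finset.mem_filter, mem_words] at hl
    obtain ⟨⟨hl, hJ⟩, hq, hrot⟩ := hl
    have hrg : l.rotate g = l := by rw [hg, ← hl]; exact rotate_gcd_eq_self hrot
    exact (eq_wordPow_of_rotate_eq (by omega) (hl.trans hk) hrg).symm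
  · intro u hu
    simp only [Finset.mem_filter, mem_words] at hu
    rw [hj, ← hu.1.1, take_wordPow, drop_wordPow]
    simp only [wordDeg_wordPow, Prod.smul_snd]
    exact (koszulSign_nsmul_mul_pow hco _).symm

theorem sum_range_gcd_eq {M : Type*} [AddCommMonoid M] (n : ℕ) (f : ℕ → M) :
    ∑ i ∈ Finset.range n, f (n.gcd i) = ∑ p ∈ n.divisorsAntidiagonal, p.2.totient • f p.1 := by
  rcases Nat.eq_zero_or_pos n with rfl | hn
  · simp
  rw [Nat.sum_divisorsAntidiagonal (f := fun a c => c.totient • f a),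
    ← Finset.sum_fiberwise_of_maps_to (t := n.divisors) (g := fun i => n.gcd i)
      (fun i _ => Nat.mem_divisors.2 ⟨Nat.gcd_dvd_left _ _, hn.ne'⟩)]
  refine Finset.sum_congr rfl fun d hd => ?_
  rw [Nat.totient_div_of_dvd (Nat.dvd_of_mem_divisors hd), ← Finset.sum_const]
  exact Finset.sum_congr rfl fun i hi => by rw [(Finset.mem_filter.1 hi).2]

end Count

/-! ### Coefficients of the series -/

theorem coeff_logOf_one_sub {A : Type*} [CommRing A] [Algebra ℚ A] (G : A⟦X⟧)
    (hG : PowerSeries.constantCoeff G = 0) (q : ℕ) :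
    PowerSeries.coeff q (PowerSeries.logOf (1 - G)) =
      -∑ g ∈ Finset.Icc 1 q, (g : ℚ)⁻¹ • PowerSeries.coeff q (G ^ g) := by
  have hs : PowerSeries.HasSubst (-G) :=
    PowerSeries.HasSubst.of_constantCoeff_zero' (by rw [map_neg, hG, neg_zero])
  rw [PowerSeries.logOf_eq, sub_sub_cancel_left, PowerSeries.coeff_subst' hs,
    finsum_eq_sum_of_support_subset (s := Finset.Icc 1 q), ← Finset.sum_neg_distrib]
  · refine Finset.sum_congr rfl fun g hg => ?_
    have hg0 : g ≠ 0 := by have := (Finset.mem_Icc.1 hg).1; omega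
    have h1 : PowerSeries.coeff q ((-G) ^ g) = (-1 : ℚ) ^ g • PowerSeries.coeff q (G ^ g) := by
      rw [neg_pow]
      rcases Nat.even_or_odd g with h | h <;> simp [h.neg_one_pow]
    rw [PowerSeries.coeff_log, if_neg hg0, h1, algebraMap_smul, smul_smul, ← neg_smul]
    congr 1
    rw [div_mul_eq_mul_div, ← pow_add, show g + 1 + g = 2 * g + 1 by ring, pow_succ, pow_mul]
    simp [neg_div]
  · intro g hg
    rw [Function.mem_support] at hg
    rw [Finset.coe_Icc, Set.mem_Icc]
    by_contra hcon
    apply hg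
    rcases Nat.eq_zero_or_pos g with rfl | hpos
    · simp
    · have hlt : q < g := by omega
      have hdvd : (PowerSeries.X : A⟦X⟧) ^ g ∣ (-G) ^ g := by
        refine pow_dvd_pow_of_dvd (PowerSeries.X_dvd_iff.2 ?_) _
        rw [map_neg, hG, neg_zero]
      rw [PowerSeries.X_pow_dvd_iff.1 hdvd q hlt, smul_zero]

/-- The substitution `powerSubst` as a ring homomorphism. -/
def powerSubstHom (k : ℕ+) : SignSeries →+* SignSeries :=
  (PowerSeries.expand (k : ℕ) k.ne_zero).toRingHom.comp (PowerSeries.map (SignRing.subst k))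

theorem powerSubstHom_apply (k : ℕ+) (F : SignSeries) : powerSubstHom k F = powerSubst k F := rfl

theorem powerSubst_monomial (k : ℕ+) (p : ℕ) (ε : ZMod 2) :
    powerSubst k (PowerSeries.monomial p (y ^ ε.val)) =
      PowerSeries.monomial (k * p) (signY k ^ ε.val) := by
  have h : PowerSeries.map (SignRing.subst k) (PowerSeries.monomial p (y ^ ε.val)) =
      PowerSeries.monomial p (signY k ^ ε.val) := by
    ext n
    rw [PowerSeries.coeff_map, PowerSeries.coeff_monomial, PowerSeries.coeff_monomial,
      apply_ite (SignRing.subst k), map_pow, subst_y, map_zero]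
  rw [powerSubst, h, PowerSeries.expand_monomial]

section WordDegree

variable {I : Type*} (deg : I → ℕ × ZMod 2)

theorem prod_map_monomial (k : ℕ) (l : List I) :
    (l.map fun i => PowerSeries.monomial (k * (deg i).1) (signY k ^ (deg i).2.val)).prod =
      PowerSeries.monomial (k * (wordDeg deg l).1) (signY k ^ (wordDeg deg l).2.val) := by
  induction l with
  | nil => simp
  | cons a l ih =>
    rw [List.map_cons, List.prod_cons, ih, PowerSeries.monomial_mul_monomial, wordDeg_cons,
      Prod.fst_add, Prod.snd_add, pow_val_add (signY_sq k), mul_add]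

theorem length_le_wordDeg (hpos : ∀ i, (deg i).1 ≠ 0) (l : List I) :
    l.length ≤ (wordDeg deg l).1 := by
  induction l with
  | nil => simp
  | cons a l ih =>
    have := hpos a
    rw [List.length_cons, wordDeg_cons, Prod.fst_add]
    omega

theorem fst_le_wordDeg {l : List I} {i : I} (hi : i ∈ l) : (deg i).1 ≤ (wordDeg deg l).1 := by
  induction l with
  | nil => simp at hi
  | cons a l ih =>
    rw [wordDeg_cons, Prod.fst_add]
    rcases List.mem_cons.1 hi with rfl | hi
    · exact Nat.le_add_right _ _
    · exact (ih hi).trans (Nat.le_add_left _ _)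

theorem signedCount_eq_zero (hpos : ∀ i, (deg i).1 ≠ 0) (J : Finset I) {q g k : ℕ}
    (h : q < g * k) : signedCount deg J q g k = 0 := by
  rw [signedCount, Finset.filter_eq_empty_iff.2, Finset.sum_empty]
  intro u hu hq
  have h1 := length_le_wordDeg deg hpos u
  rw [(mem_words.1 hu).1] at h1
  have := Nat.mul_le_mul_left k h1
  rw [hq, mul_comm] at this
  omega

end WordDegree

section Letters

variable {I : Type*} [DecidableEq I] (deg : I → ℕ × ZMod 2) (fib : ℕ → Finset I)
  (hfib : ∀ p i, i ∈ fib p ↔ (deg i).1 = p)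

/-- The letters of weight at most `q`, given the sets of letters of each weight. -/
def letters (q : ℕ) : Finset I := (Finset.range (q + 1)).biUnion fib

include hfib in
theorem mem_letters (q : ℕ) (i : I) : i ∈ letters fib q ↔ (deg i).1 ≤ q := by
  simp [letters, hfib]

include hfib in
theorem coeff_powerSubst_pow (F : SignSeries)
    (hF : ∀ p, PowerSeries.coeff p F = ∑ i ∈ fib p, y ^ (deg i).2.val) (k : ℕ+) (q g : ℕ) :
    PowerSeries.coeff q (powerSubst k F ^ g) = signedCount deg (letters fib q) q g k := by
  set S : SignSeries := ∑ i ∈ letters fib q, PowerSeries.monomial (deg i).1 (y ^ (deg i).2.val)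
    with hS
  have h1 : (PowerSeries.X : SignSeries) ^ (q + 1) ∣ F - S := by
    refine PowerSeries.X_pow_dvd_iff.2 fun p hp => ?_
    rw [map_sub, hF, hS, map_sum, sub_eq_zero]
    simp only [PowerSeries.coeff_monomial]
    rw [← Finset.sum_filter]
    refine Finset.sum_congr ?_ fun _ _ => rfl
    ext i
    simp only [Finset.mem_filter, mem_letters deg fib hfib, hfib]
    omega
  have h2 : (PowerSeries.X : SignSeries) ^ (q + 1) ∣ powerSubst k F ^ g - powerSubst k S ^ g := by
    refine dvd_trans ?_ (sub_dvd_pow_sub_pow _ _ g)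
    simp only [← powerSubstHom_apply, ← map_sub]
    refine dvd_trans ?_ (map_dvd (powerSubstHom k) h1)
    rw [map_pow, powerSubstHom_apply, powerSubst, PowerSeries.map_X, PowerSeries.expand_X]
    exact pow_dvd_pow_of_dvd (dvd_pow_self _ k.ne_zero) _
  have h3 := PowerSeries.X_pow_dvd_iff.1 h2 q (Nat.lt_succ_self q)
  rw [map_sub, sub_eq_zero] at h3
  rw [h3, hS, ← powerSubstHom_apply, map_sum]
  simp only [powerSubstHom_apply, powerSubst_monomial]
  rw [← sum_words, map_sum, signedCount, Finset.sum_filter]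
  refine Finset.sum_congr rfl fun l _ => ?_
  rw [prod_map_monomial, PowerSeries.coeff_monomial]
  simp only [eq_comm]

include hfib in
theorem coeff_hcfreeTerm (hpos : ∀ i, (deg i).1 ≠ 0) (F : SignSeries)
    (hF : ∀ p, PowerSeries.coeff p F = ∑ i ∈ fib p, y ^ (deg i).2.val) (k : ℕ+) (q : ℕ) :
    PowerSeries.coeff q (hcfreeTerm F k) = -∑ g ∈ Finset.Icc 1 q,
      ((k : ℕ).totient / ((g * k : ℕ) : ℚ)) • signedCount deg (letters fib q) q g k := by
  have hF0 : PowerSeries.constantCoeff F = 0 := by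
    rw [← PowerSeries.coeff_zero_eq_constantCoeff_apply, hF]
    refine Finset.sum_eq_zero fun i hi => ?_
    exact absurd ((hfib 0 i).1 hi) (hpos i)
  have h0 : PowerSeries.constantCoeff (powerSubst k F) = 0 := by
    rw [powerSubst, PowerSeries.constantCoeff_expand, ← PowerSeries.coeff_zero_eq_constantCoeff_apply,
      PowerSeries.coeff_map, PowerSeries.coeff_zero_eq_constantCoeff_apply, hF0, map_zero]
  rw [hcfreeTerm, map_rat_smul, coeff_logOf_one_sub _ h0, smul_neg, Finset.smul_sum]
  congr 1
  refine Finset.sum_congr rfl fun g _ => ?_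
  rw [coeff_powerSubst_pow deg fib hfib F hF, smul_smul]
  congr 1
  push_cast
  rw [mul_comm (g : ℚ), div_mul_eq_div_div, div_eq_mul_inv _ (g : ℚ)]

/-- The coefficient of weight `q` of the cyclic homology series, as a sum over the pairs of a
length `p.1` of a primitive block and a number `p.2` of repetitions. -/
def cyclicCount (q : ℕ) : SignRing :=
  ∑ n ∈ Finset.Icc 1 q, ∑ p ∈ n.divisorsAntidiagonal,
    ((p.2.totient : ℚ) / (n : ℚ)) • signedCount deg (letters fib q) q p.1 p.2

theorem cyclicCount_eq_sum (hpos : ∀ i, (deg i).1 ≠ 0) (q : ℕ) :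
    cyclicCount deg fib q = ∑ k ∈ Finset.Icc 1 q, ∑ g ∈ Finset.Icc 1 q,
      ((k.totient : ℚ) / ((g * k : ℕ) : ℚ)) • signedCount deg (letters fib q) q g k := by
  rw [Finset.sum_comm, ← Finset.sum_product' (f := fun g k => ((k.totient : ℚ) /
    ((g * k : ℕ) : ℚ)) • signedCount deg (letters fib q) q g k), cyclicCount]
  have hz : ∀ p ∈ Finset.Icc 1 q ×ˢ Finset.Icc 1 q,
      ((p.2.totient : ℚ) / ((p.1 * p.2 : ℕ) : ℚ)) •
        signedCount deg (letters fib q) q p.1 p.2 ≠ 0 → p.1 * p.2 ≤ q := by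
    intro p _ hp
    by_contra hlt
    exact hp (by rw [signedCount_eq_zero deg hpos _ (not_le.1 hlt), smul_zero])
  rw [← Finset.sum_filter_of_ne hz, ← Finset.sum_fiberwise_of_maps_to (t := Finset.Icc 1 q)
    (g := fun p : ℕ × ℕ => p.1 * p.2)]
  · refine Finset.sum_congr rfl fun n hn => ?_
    refine Finset.sum_congr ?_ fun p hp => by rw [(Finset.mem_filter.1 hp).2]
    ext ⟨g, k⟩
    simp only [Finset.mem_filter, Finset.mem_product, Finset.mem_Icc, Nat.mem_divisorsAntidiagonal]
      at hn ⊢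
    constructor
    · rintro ⟨rfl, h⟩
      have hg : g ≠ 0 := left_ne_zero_of_mul h
      have hk : k ≠ 0 := right_ne_zero_of_mul h
      have h1 := Nat.le_mul_of_pos_right g (Nat.pos_of_ne_zero hk)
      have h2 := Nat.le_mul_of_pos_left k (Nat.pos_of_ne_zero hg)
      exact ⟨⟨⟨⟨by omega, by omega⟩, by omega, by omega⟩, hn.2⟩, rfl⟩
    · rintro ⟨_, rfl⟩
      exact ⟨rfl, by omega⟩
  · intro p hp
    simp only [Finset.mem_filter, Finset.mem_product, Finset.mem_Icc] at hp ⊢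
    exact ⟨Nat.mul_pos hp.1.1.1 hp.1.2.1, hp.2⟩

include hfib in
theorem hasSum_hcfreeTerm (hpos : ∀ i, (deg i).1 ≠ 0) (F : SignSeries)
    (hF : ∀ p, PowerSeries.coeff p F = ∑ i ∈ fib p, y ^ (deg i).2.val) :
    HasSum (hcfreeTerm F) (-PowerSeries.mk (cyclicCount deg fib)) := by
  rw [PowerSeries.WithPiTopology.hasSum_iff_hasSum_coeff]
  intro q
  have h := hasSum_sum_of_ne_finset_zero (f := fun k => PowerSeries.coeff q (hcfreeTerm F k))
    (s := (Finset.Icc 1 q).image Nat.toPNat') (L := SummationFilter.unconditional ℕ+) ?_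
  · convert h using 1
    rw [map_neg, PowerSeries.coeff_mk, cyclicCount_eq_sum deg fib hpos, ← Finset.sum_neg_distrib,
      Finset.sum_image]
    · refine Finset.sum_congr rfl fun k hk => ?_
      rw [coeff_hcfreeTerm deg fib hfib hpos F hF, Nat.toPNat'_coe,
        if_pos (Nat.pos_of_ne_zero (by have := (Finset.mem_Icc.1 hk).1; omega))]
    · intro a ha c hc hac
      have := congrArg PNat.val hac
      simp only [Finset.coe_Icc, Set.mem_Icc] at ha hc
      rwa [Nat.toPNat'_coe, Nat.toPNat'_coe, if_pos (by omega), if_pos (by omega)] at this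
  · intro k hk
    have hkq : q < k := by
      by_contra hle
      refine hk (Finset.mem_image.2 ⟨k, Finset.mem_Icc.2 ⟨k.pos, not_lt.1 hle⟩, ?_⟩)
      simp
    rw [coeff_hcfreeTerm deg fib hfib hpos F hF, neg_eq_zero]
    refine Finset.sum_eq_zero fun g hg => ?_
    rw [signedCount_eq_zero deg hpos, smul_zero]
    exact hkq.trans_le (Nat.le_mul_of_pos_left _ (Finset.mem_Icc.1 hg).1)

/-- The words of weight `q`. -/
def wordsOfWeight (q : ℕ) : Finset (List I) :=
  {l ∈ (Finset.range (q + 1)).biUnion (words (letters fib q)) | (wordDeg deg l).1 = q}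

include hfib in
theorem mem_wordsOfWeight (hpos : ∀ i, (deg i).1 ≠ 0) (q : ℕ) (l : List I) :
    l ∈ wordsOfWeight deg fib q ↔ (wordDeg deg l).1 = q := by
  simp only [wordsOfWeight, Finset.mem_filter, Finset.mem_biUnion, Finset.mem_range, mem_words,
    mem_letters deg fib hfib, and_iff_right_iff_imp]
  rintro rfl
  exact ⟨_, Nat.lt_succ_of_le (length_le_wordDeg deg hpos l), rfl,
    fun i hi => fst_le_wordDeg deg hi⟩

/-- The trace contribution of a word to the cyclic average. -/
def wordTrace (R : Type*) [CommRing R] [Algebra ℚ R] (l : List I) : R :=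
  (l.length : ℚ)⁻¹ • ∑ i ∈ Finset.range l.length, if l.rotate i = l then
    koszulSign R (wordDeg deg (l.take i)).2 (wordDeg deg (l.drop i)).2 else 0

theorem algebraMap_wordTrace (R : Type*) [CommRing R] [Algebra ℚ R] (l : List I) :
    algebraMap ℚ R (wordTrace deg ℚ l) = wordTrace deg R l := by
  rw [wordTrace, wordTrace, map_rat_smul]
  simp [apply_ite (algebraMap ℚ R), koszulSign]

theorem sum_wordTrace (q : ℕ) :
    ∑ l ∈ wordsOfWeight deg fib q, wordTrace deg SignRing l * y ^ (wordDeg deg l).2.val =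
      cyclicCount deg fib q := by
  rw [wordsOfWeight, Finset.sum_filter, Finset.sum_biUnion, Finset.sum_range_eq_add_Ico _ q.succ_pos,
    cyclicCount]
  · have h0 : ∑ l ∈ words (letters fib q) 0, (if (wordDeg deg l).1 = q then
        wordTrace deg SignRing l * y ^ (wordDeg deg l).2.val else 0) = 0 := by
      simp [words, wordTrace]
    rw [h0, zero_add]
    refine Finset.sum_congr (by ext; simp) fun n hn => ?_
    have hp : ∑ p ∈ n.divisorsAntidiagonal,
        ((p.2.totient : ℚ) / (n : ℚ)) • signedCount deg (letters fib q) q p.1 p.2 =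
        (n : ℚ)⁻¹ • ∑ p ∈ n.divisorsAntidiagonal,
          p.2.totient • signedCount deg (letters fib q) q p.1 (n / p.1) := by
      rw [Finset.smul_sum]
      refine Finset.sum_congr rfl fun p hp => ?_
      obtain ⟨h1, h2⟩ := Nat.mem_divisorsAntidiagonal.1 hp
      rw [← Nat.cast_smul_eq_nsmul ℚ, smul_smul, div_eq_inv_mul, ← h1,
        Nat.mul_div_cancel_left _ (Nat.pos_of_ne_zero (by rintro h; simp [h] at h1; omega))]
    rw [hp, ← sum_range_gcd_eq n fun g => signedCount deg (letters fib q) q g (n / g)]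
    rw [Finset.sum_congr rfl fun i hi => (sum_fixed_eq_signedCount deg (letters fib q)
      (Finset.mem_range.1 hi) q).symm]
    simp only [Finset.sum_filter]
    rw [Finset.sum_comm, Finset.smul_sum]
    refine Finset.sum_congr rfl fun l hl => ?_
    rw [wordTrace, (mem_words.1 hl).1]
    split_ifs with hq
    · rw [smul_mul_assoc, Finset.sum_mul]
      simp [hq, ite_mul]
    · simp [hq]
  · intro a _ c _ hac
    refine Finset.disjoint_left.2 fun l hl hl' => hac ?_
    rw [← (mem_words.1 hl).1, (mem_words.1 hl').1]

variable {K V : Type*} [Field K] [AddCommGroup V] [Module K V] (b : Basis I K V)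
  (𝒱 : ℕ × ZMod 2 → Submodule K V)
  (h𝒱 : ∀ d, 𝒱 d = Submodule.span K (b '' {i | deg i = d}))

include hfib h𝒱 b in
theorem hilbertSeries_hcPiece [CharZero K] (hpos : ∀ i, (deg i).1 ≠ 0) :
    hilbertSeries (hcPiece 𝒱) = PowerSeries.mk (cyclicCount deg fib) := by
  ext q
  rw [hilbertSeries, PowerSeries.coeff_mk, PowerSeries.coeff_mk, ← sum_wordTrace,
    ← Finset.sum_fiberwise _ (fun l => (wordDeg deg l).2)]
  refine Finset.sum_congr rfl fun ε _ => ?_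
  have hfr := finrank_hcPiece b deg 𝒱 h𝒱 (d := (q, ε))
    {l ∈ wordsOfWeight deg fib q | (wordDeg deg l).2 = ε} fun l => by
      rw [Finset.mem_filter, mem_wordsOfWeight deg fib hfib hpos, Prod.ext_iff]
  have hQ : (finrank K (hcPiece 𝒱 (q, ε)) : ℚ) =
      ∑ l ∈ wordsOfWeight deg fib q with (wordDeg deg l).2 = ε, wordTrace deg ℚ l := by
    apply (algebraMap ℚ K).injective
    rw [map_natCast, hfr, map_sum]
    refine Finset.sum_congr rfl fun l _ => ?_
    rw [algebraMap_wordTrace, wordTrace, Algebra.smul_def, map_inv₀, map_natCast]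
  rw [← map_natCast (algebraMap ℚ SignRing), hQ, map_sum, Finset.sum_mul]
  refine Finset.sum_congr rfl fun l hl => ?_
  rw [algebraMap_wordTrace, (Finset.mem_filter.1 hl).2]

end Letters

end CyclicHomology

end

theorem mainTheorem3 {K : Type*} [Field K] [CharZero K]
    {V : Type*} [AddCommGroup V] [Module K V]
    (𝒱 : ℕ × ZMod 2 → Submodule K V)
    (hV : DirectSum.IsInternal 𝒱)
    (hpos : ∀ ε : ZMod 2, 𝒱 (0, ε) = ⊥)
    (hfin : ∀ d : ℕ × ZMod 2, FiniteDimensional K (𝒱 d)) :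
    DirectSum.IsInternal (CyclicHomology.hcPiece 𝒱) ∧
    (∀ d : ℕ × ZMod 2, FiniteDimensional K (CyclicHomology.hcPiece 𝒱 d)) ∧
    Summable (CyclicHomology.hcfreeTerm (CyclicHomology.hilbertSeries 𝒱)) ∧
    CyclicHomology.hilbertSeries (CyclicHomology.hcPiece 𝒱) =
      CyclicHomology.hcfree (CyclicHomology.hilbertSeries 𝒱) := by
  classical
  let v := fun d => Module.finBasis K (𝒱 d)
  let b := hV.collectedBasis v
  let deg : (Σ d : ℕ × ZMod 2, Fin (Module.finrank K (𝒱 d))) → ℕ × ZMod 2 := Sigma.fst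
  let fib : ℕ → Finset (Σ d : ℕ × ZMod 2, Fin (Module.finrank K (𝒱 d))) := fun p =>
    (({p} : Finset ℕ) ×ˢ Finset.univ).sigma fun _ => Finset.univ
  have hfib : ∀ p i, i ∈ fib p ↔ (deg i).1 = p := fun p i => by
    obtain ⟨⟨_, _⟩, _⟩ := i
    simp [fib, deg, eq_comm]
  have h𝒱 : ∀ d, 𝒱 d = Submodule.span K (b '' {i | deg i = d}) := fun d => by
    have h : b '' {i | deg i = d} = Set.range fun j => (v d j : V) := by
      ext x
      constructor
      · rintro ⟨⟨_, j⟩, rfl, rfl⟩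
        exact ⟨j, by simp [b, deg]⟩
      · rintro ⟨j, rfl⟩
        exact ⟨⟨d, j⟩, rfl, by simp [b]⟩
    rw [h, Set.range_comp' (Subtype.val) (v d), ← Submodule.coe_subtype, ← Submodule.map_span,
      (v d).span_eq, Submodule.map_top, Submodule.range_subtype]
  have hdeg : ∀ i, (deg i).1 ≠ 0 := by
    rintro ⟨⟨p, ε⟩, j⟩ (rfl : p = 0)
    have h0 : Module.finrank K (𝒱 (0, ε)) = 0 := by rw [hpos]; exact finrank_bot K V
    exact absurd j.2 (by omega)
  have hF : ∀ p, PowerSeries.coeff p (CyclicHomology.hilbertSeries 𝒱) =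
      ∑ i ∈ fib p, CyclicHomology.SignRing.y ^ (deg i).2.val := fun p => by
    rw [CyclicHomology.hilbertSeries, PowerSeries.coeff_mk, Finset.sum_sigma, Finset.sum_product]
    simp [deg]
  have hsum := CyclicHomology.hasSum_hcfreeTerm deg fib hfib hdeg _ hF
  refine ⟨CyclicHomology.isInternal_hcPiece b deg 𝒱 h𝒱, fun d => ?_, hsum.summable, ?_⟩
  · refine CyclicHomology.finiteDimensional_hcPiece b deg 𝒱 h𝒱
      ((CyclicHomology.wordsOfWeight deg fib d.1).finite_toSet.subset fun l hl => ?_)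
    rw [Finset.mem_coe, CyclicHomology.mem_wordsOfWeight deg fib hfib hdeg]
    exact congrArg Prod.fst hl
  · rw [CyclicHomology.hcfree, hsum.tsum_eq, neg_neg,
      CyclicHomology.hilbertSeries_hcPiece deg fib hfib b 𝒱 h𝒱 hdeg]
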